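/- Let $2\le n\le N$ be integers and let $Z=(z_{j,r})\in\{0,1\}^{N\times n}$ be a $0$–$1$ matrix with $N$ rows and $n$ columns. Write $[m]=\{1,\dots,m\}$ and $[m]^2_{\neq}=\{(a,b)\in[m]^2: a\neq b\}$. Let $$\mathrm{Per}(Z)=\sum_{j}\prod_{r=1}^n z_{j(r),r},$$ where $j$ runs over all injective maps $[n]\to[N]$, and put $$\widetilde z_r=\frac1N\sum_{j=1}^N z_{j,r},\qquad \beta=\frac1n\sum_{r=1}^n|\widetilde z_r|^2,$$ $$\vartheta=\frac{1}{N(N-1)\sqrt{n(n-1)}}\Big(\sum_{(r,s)\in[n]^2_{\neq}}\Big(\sum_{(u,v)\in[N]^2_{\neq}}\big|(z_{u,r}-z_{v,r})(z_{u,s}-z_{v,s})\big|\Big)^2\Big)^{1/2},$$ $$f_n(x_1,x_2)=\sum_{k=2}^n (k-1)\,x_1^{\,n-k}x_2^{\,k-2}\qquad(x_1,x_2\in\mathbb R,\ 0^0=1).$$ Let $\zeta(0)=0$ and $\zeta(k)=(k!)^{1/k}$ for integers $k\ge1$. For $(u,v)\in[N]^2_{\neq}$ and $\ell\in[n]$ let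 $$\eta_{u,v,\ell}=\sum_{j\in[N]\setminus\{u,v\}}z_{j,\ell},\qquad \widetilde\kappa_{u,v,\ell}=\frac{\zeta(\eta_{u,v,\ell})^2}{((N-2)!)^{2/(N-2)}}\quad(N\ge3),$$ and set $$\widetilde\kappa=\frac1{n-2}\max_{(u,v)\in[N]^2_{\neq},\ (r,s)\in[n]^2_{\neq}}\ \sum_{\ell\in[n]\setminus\{r,s\}}\widetilde\kappa_{u,v,\ell}\quad\text{if } n\ge3,\qquad \widetilde\kappa=1\quad\text{if } n=2.$$ Then $$\Big|\frac{(N-n)!}{N!}\,\mathrm{Per}(Z)-\prod_{r=1}^n\widetilde z_r\Big|\le\frac{\vartheta}{2N}\,f_n\big(\sqrt\beta,\sqrt{\widetilde\kappa}\big).$$ -/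

import Mathlib

namespace PermanentApprox

/-- The permanent of a rectangular `N × n` matrix: the sum over all injective maps
`j : {1,…,n} → {1,…,N}` of the products `∏ r, Z (j r) r`. -/
noncomputable def rectPermanent {N n : ℕ} (Z : Matrix (Fin N) (Fin n) ℂ) : ℂ :=
  ∑ j : Fin n ↪ Fin N, ∏ r : Fin n, Z (j r) r

/-- The arithmetic mean of the entries of column `r`. -/
noncomputable def colMean {N n : ℕ} (Z : Matrix (Fin N) (Fin n) ℂ) (r : Fin n) : ℂ :=
  (1 / (N : ℂ)) * ∑ j : Fin N, Z j r

/-- `β`, the mean of the squared absolute values of the column means. -/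
noncomputable def beta {N n : ℕ} (Z : Matrix (Fin N) (Fin n) ℂ) : ℝ :=
  (1 / (n : ℝ)) * ∑ r : Fin n, ‖colMean Z r‖ ^ 2

/-- `ϑ`; the sums run over ordered pairs `(r, s)` of distinct columns and ordered pairs
`(u, v)` of distinct rows. -/
noncomputable def vartheta {N n : ℕ} (Z : Matrix (Fin N) (Fin n) ℂ) : ℝ :=
  1 / ((N : ℝ) * ((N : ℝ) - 1) * Real.sqrt ((n : ℝ) * ((n : ℝ) - 1))) *
    Real.sqrt (∑ c ∈ (Finset.univ : Finset (Fin n)).offDiag,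
      (∑ p ∈ (Finset.univ : Finset (Fin N)).offDiag,
        ‖(Z p.1 c.1 - Z p.2 c.1) * (Z p.1 c.2 - Z p.2 c.2)‖) ^ 2)

/-- `f_n(x₁, x₂) = ∑_{k=2}^n (k-1) x₁^{n-k} x₂^{k-2}` (with `0^0 = 1`). -/
noncomputable def fPoly (n : ℕ) (x₁ x₂ : ℝ) : ℝ :=
  ∑ k ∈ Finset.Icc 2 n, ((k : ℝ) - 1) * x₁ ^ (n - k) * x₂ ^ (k - 2)

/-- `ζ(0) = 0` and `ζ(k) = (k!)^{1/k}` for `k ≥ 1`. -/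
noncomputable def zeta (k : ℕ) : ℝ :=
  if k = 0 then 0 else (k.factorial : ℝ) ^ (1 / (k : ℝ))

/-- `η_{u,v,ℓ}`: the sum of column `ℓ` after removal of the rows `u` and `v`. -/
def eta {N n : ℕ} (Z : Matrix (Fin N) (Fin n) ℕ) (u v : Fin N) (l : Fin n) : ℕ :=
  ∑ j ∈ Finset.univ \ {u, v}, Z j l

/-- `κ̃_{u,v,ℓ} = ζ(η_{u,v,ℓ})² / ((N-2)!)^{2/(N-2)}`; only used for `N ≥ 3`. -/
noncomputable def kappaTildeEntry {N n : ℕ} (Z : Matrix (Fin N) (Fin n) ℕ)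
    (u v : Fin N) (l : Fin n) : ℝ :=
  zeta (eta Z u v l) ^ 2 / (((N - 2).factorial : ℝ) ^ (2 / ((N : ℝ) - 2)))

/-- `κ̃`. For `3 ≤ n ≤ N` the supremum runs over a finite nonempty family (all ordered pairs
`(u, v)` of distinct rows and `(r, s)` of distinct columns), so it is a maximum. -/
noncomputable def kappaTilde {N n : ℕ} (Z : Matrix (Fin N) (Fin n) ℕ) : ℝ :=
  if 3 ≤ n then
    1 / ((n : ℝ) - 2) *
      ⨆ q : {p : Fin N × Fin N // p.1 ≠ p.2} × {c : Fin n × Fin n // c.1 ≠ c.2},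
        ∑ l ∈ Finset.univ \ {q.2.1.1, q.2.1.2}, kappaTildeEntry Z q.1.1.1 q.1.1.2 l
  else 1

end PermanentApprox

/-! Write `P K` for the normalised permanent of the columns in `K`, that is, the mean over all
permutations `σ` of the rows of `∏ r ∈ K, Z (σ (c r)) r`, where `c` is any fixed injection of
columns into rows. Let `levelMean` at `k` be the mean over `#K = k` of `P K` times the column means
outside `K`. It equals the product of the column means at `k = 0` and the normalised permanent at `k
= n`, so the error is a telescoping sum of increments built from `P K - z s * P (K.erase s)`.

Each increment is a sum over `r ∈ K.erase s`. Exchanging the values of `σ` at the positions of `r`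
and `s` turns its terms into products of two row differences, one in column `r` and one in column
`s`, times the entries of the other columns of `K` (`permSum_sub_eq`, `two_mul_sum_perm_exchange`).
With those two values fixed at `u` and `v`, what remains is the permanent of a `0`-`1` matrix
without the rows `u`, `v`, and Bregman's theorem (`card_permsWithin_le`) bounds it by a product of
ratios `zeta (eta Z u v q) / zeta (N - 2)`.

Two applications of Cauchy–Schwarz, over `K` and over pairs of columns, separate the row differences
(giving `vartheta`) from symmetric sums of squares. Maclaurin's inequality (`elemSym_mul_pow_le`)
bounds the latter by powers of `kappaTilde` and `beta`. -/

namespace PermanentApprox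

open Finset Equiv

/-! ### Bregman's theorem, by Schrijver's convexity argument -/

section Bregman

theorem natCast_mul_log_zeta (k : ℕ) : (k : ℝ) * Real.log (zeta k) = Real.log k.factorial := by
  rcases eq_or_ne k 0 with rfl | hk
  · simp
  · have h : (0 : ℝ) < k.factorial := by exact_mod_cast k.factorial_pos
    rw [zeta, if_neg hk, Real.log_rpow h, ← mul_assoc,
      mul_one_div_cancel (by exact_mod_cast hk), one_mul]

theorem zeta_nonneg (k : ℕ) : 0 ≤ zeta k := by
  unfold zeta; split_ifs <;> positivity

theorem zeta_pos {k : ℕ} (hk : k ≠ 0) : 0 < zeta k := by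
  have h : (0 : ℝ) < k.factorial := by exact_mod_cast k.factorial_pos
  rw [zeta, if_neg hk]; positivity

theorem zeta_pow_self (k : ℕ) : zeta k ^ k = k.factorial := by
  rcases eq_or_ne k 0 with rfl | hk
  · simp
  · rw [zeta, if_neg hk, one_div, Real.rpow_inv_natCast_pow (by positivity) hk]

/-- The log-sum inequality against the uniform weights on `s`. -/
theorem sum_mul_log_sum_le {ι : Type*} (s : Finset ι) (f : ι → ℝ) (hf : ∀ i ∈ s, 0 ≤ f i) :
    (∑ i ∈ s, f i) * Real.log (∑ i ∈ s, f i) ≤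
      (∑ i ∈ s, f i) * Real.log #s + ∑ i ∈ s, f i * Real.log (f i) := by
  set p := ∑ i ∈ s, f i with hp
  rcases (sum_nonneg hf).eq_or_lt with h0 | hpos
  · have h1 : ∀ i ∈ s, f i = 0 := (sum_eq_zero_iff_of_nonneg hf).1 h0.symm
    rw [← hp] at h0
    rw [← h0, sum_eq_zero fun i hi => by rw [h1 i hi, zero_mul]]
    simp
  rw [← hp] at hpos
  have hs : s.Nonempty := by
    by_contra h
    rw [not_nonempty_iff_eq_empty] at h
    simp [hp, h] at hpos
  have hr : (0 : ℝ) < #s := by exact_mod_cast hs.card_pos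
  -- This is `log x ≤ x - 1` at `x = p / (#s * f i)`, multiplied by `f i`; the right sides sum to
  -- zero.
  have key : ∀ i ∈ s, f i * (Real.log p - Real.log #s - Real.log (f i)) ≤ p / #s - f i := by
    intro i hi
    rcases (hf i hi).eq_or_lt with h | h
    · rw [← h]; simp; positivity
    · have h1 : Real.log (p / (#s * f i)) ≤ p / (#s * f i) - 1 :=
        Real.log_le_sub_one_of_pos (by positivity)
      rw [Real.log_div hpos.ne' (by positivity), Real.log_mul hr.ne' h.ne'] at h1
      calc f i * (Real.log p - Real.log #s - Real.log (f i))
          ≤ f i * (p / (#s * f i) - 1) := mul_le_mul_of_nonneg_left (by linarith) h.le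
        _ = p / #s - f i := by field_simp
  have h2 := sum_le_sum key
  rw [sum_sub_distrib, sum_const, nsmul_eq_mul, mul_div_cancel₀ _ hr.ne', ← hp] at h2
  simp only [mul_sub, sum_sub_distrib, ← sum_mul, ← hp] at h2
  linarith

variable {α : Type*} [Fintype α] [DecidableEq α]

/-- The permutations `σ` with `σ i ∈ A i` for all `i`; their number is the permanent of the
`0`-`1` matrix whose rows have supports `A i`. -/
def permsWithin (A : α → Finset α) : Finset (Perm α) :=
  univ.filter fun σ => ∀ i, σ i ∈ A i

/-- Force the value `k` in row `i` and remove it from all other rows. -/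
def fixRow (A : α → Finset α) (i k : α) (j : α) : Finset α :=
  if j = i then {k} else (A j).erase k

theorem mem_permsWithin {A : α → Finset α} {σ : Perm α} :
    σ ∈ permsWithin A ↔ ∀ i, σ i ∈ A i := by
  simp [permsWithin]

theorem permsWithin_fixRow (A : α → Finset α) {i k : α} (hk : k ∈ A i) :
    permsWithin (fixRow A i k) = (permsWithin A).filter fun σ => σ i = k := by
  ext σ
  simp only [mem_permsWithin, mem_filter, fixRow]
  constructor
  · intro h
    have hi : σ i = k := by simpa using h i
    refine ⟨fun j => ?_, hi⟩
    by_cases hj : j = i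
    · rw [hj, hi]; exact hk
    · have := h j
      rw [if_neg hj] at this
      exact mem_of_mem_erase this
  · rintro ⟨h, hi⟩ j
    by_cases hj : j = i
    · simp [hj, hi]
    · rw [if_neg hj, mem_erase]
      exact ⟨fun hc => hj (σ.injective (hc.trans hi.symm)), h j⟩

/-- Every row `i` outside `I` is a singleton disjoint from all other rows. -/
def RowsFixedOff (I : Finset α) (A : α → Finset α) : Prop :=
  ∀ i ∉ I, #(A i) = 1 ∧ ∀ j, j ≠ i → Disjoint (A i) (A j)

omit [Fintype α] in
theorem RowsFixedOff.fixRow {I : Finset α} {A : α → Finset α} (h : RowsFixedOff I A) {i k : α}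
    (hi : i ∈ I) (hk : k ∈ A i) : RowsFixedOff (I.erase i) (fixRow A i k) := by
  intro j hj
  unfold PermanentApprox.fixRow
  by_cases hji : j = i
  · subst hji
    refine ⟨by simp, fun l hl => ?_⟩
    simp [hl]
  · have hjI : j ∉ I := fun hc => hj (mem_erase.2 ⟨hji, hc⟩)
    obtain ⟨h1, h2⟩ := h j hjI
    have hkj : k ∉ A j := fun hc => disjoint_left.1 (h2 i (Ne.symm hji)) hc hk
    rw [if_neg hji, erase_eq_of_notMem hkj]
    refine ⟨h1, fun l hl => ?_⟩
    split_ifs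
    · simpa using hkj
    · exact (h2 l hl).mono_right (erase_subset _ _)

/-- Every value of `A j` other than `σ j` is taken by `σ` exactly once. The rows outside `I` are
disjoint from `A j`, so it is taken at a position in `I`. -/
theorem card_filter_mem_row {I : Finset α} {A : α → Finset α} (h : RowsFixedOff I A)
    {σ : Perm α} (hσ : σ ∈ permsWithin A) {j : α} :
    #((I.erase j).filter fun i => σ i ∈ A j) = #(A j) - 1 := by
  rw [mem_permsWithin] at hσ
  rw [← card_erase_of_mem (hσ j)]
  refine card_bij (fun i _ => σ i) ?_ (fun _ _ _ _ e => σ.injective e) ?_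
  · intro i hi
    simp only [mem_filter, mem_erase] at hi
    exact mem_erase.2 ⟨fun e => hi.1.1 (σ.injective e), hi.2⟩
  · intro k hk
    rw [mem_erase] at hk
    refine ⟨σ.symm k, ?_, by simp⟩
    have hne : σ.symm k ≠ j := fun e => hk.1 (by rw [← e]; simp)
    simp only [mem_filter, mem_erase, apply_symm_apply]
    refine ⟨⟨hne, ?_⟩, hk.2⟩
    by_contra hc
    have h1 := hσ (σ.symm k)
    rw [apply_symm_apply] at h1
    exact disjoint_left.1 ((h _ hc).2 j (Ne.symm hne)) h1 hk.2

/-- Fix `j` and put `r = #(A j)`. Of the other `i ∈ I`, exactly `r - 1` have `σ i ∈ A j` and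
together contribute `log (r - 1)!`; the remaining `#I - r` contribute `log (zeta r)` each. Adding
`log r` gives `log r! = r * log (zeta r)`, so the total does not depend on `σ`. -/
theorem sum_log_zeta_erase {I : Finset α} {A : α → Finset α} (h : RowsFixedOff I A)
    {σ : Perm α} (hσ : σ ∈ permsWithin A) :
    ∑ i ∈ I, (Real.log #(A i) + ∑ j ∈ I.erase i, Real.log (zeta #((A j).erase (σ i)))) =
      #I * ∑ j ∈ I, Real.log (zeta #(A j)) := by
  have hswap : ∑ i ∈ I, ∑ j ∈ I.erase i, Real.log (zeta #((A j).erase (σ i))) =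
      ∑ j ∈ I, ∑ i ∈ I.erase j, Real.log (zeta #((A j).erase (σ i))) := by
    refine sum_comm' fun i j => ?_
    simp only [mem_erase]; tauto
  rw [sum_add_distrib, hswap, ← sum_add_distrib, mul_sum]
  refine sum_congr rfl fun j hj => ?_
  have hσ' := mem_permsWithin.1 hσ
  have hr : 0 < #(A j) := card_pos.2 ⟨_, hσ' j⟩
  have h1 : ∀ i ∈ I.erase j, Real.log (zeta #((A j).erase (σ i))) =
      if σ i ∈ A j then Real.log (zeta (#(A j) - 1)) else Real.log (zeta #(A j)) := by
    intro i _
    split_ifs with hc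
    · rw [card_erase_of_mem hc]
    · rw [erase_eq_of_notMem hc]
  have hcard := card_filter_add_card_filter_not (s := I.erase j) (fun i => σ i ∈ A j)
  rw [card_filter_mem_row h hσ, card_erase_of_mem hj] at hcard
  rw [sum_congr rfl h1, sum_ite, sum_const, sum_const, card_filter_mem_row h hσ,
    nsmul_eq_mul, nsmul_eq_mul, natCast_mul_log_zeta]
  have hI : 0 < #I := card_pos.2 ⟨j, hj⟩
  obtain ⟨r, hr'⟩ : ∃ r, #(A j) = r + 1 := ⟨#(A j) - 1, by omega⟩
  have hq : (#((I.erase j).filter fun i => ¬ σ i ∈ A j) : ℝ) = #I - (r + 1) := by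
    have : #((I.erase j).filter fun i => ¬ σ i ∈ A j) + (r + 1) = #I := by omega
    rw [← this]; push_cast; ring
  rw [hq, hr', Nat.add_sub_cancel]
  have h2 := natCast_mul_log_zeta (r + 1)
  have h3 : Real.log ((r + 1).factorial : ℝ) =
      Real.log ((r + 1 : ℕ) : ℝ) + Real.log (r.factorial : ℝ) := by
    rw [Nat.factorial_succ, Nat.cast_mul, Real.log_mul (by positivity) (by positivity)]
  rw [h3] at h2
  push_cast at h2 ⊢
  linarith

/-- **Bregman's theorem** (Minc's conjecture), in a form stable under expansion along rows. -/
theorem card_permsWithin_le {I : Finset α} {A : α → Finset α} (h : RowsFixedOff I A) :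
    (#(permsWithin A) : ℝ) ≤ ∏ i ∈ I, zeta #(A i) := by
  induction hm : #I generalizing I A with
  | zero =>
    rw [card_eq_zero] at hm
    subst hm
    rw [prod_empty]
    norm_cast
    -- With `I` empty all rows are singletons, so at most one permutation is admissible.
    refine card_le_one.2 fun σ hσ τ hτ => Equiv.ext fun i => ?_
    rw [mem_permsWithin] at hσ hτ
    exact card_le_one.1 (h i (by simp)).1.le _ (hσ i) _ (hτ i)
  | succ m ih =>
    rcases (permsWithin A).eq_empty_or_nonempty with hS | hS
    · rw [hS]; simp only [card_empty, Nat.cast_zero]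
      exact prod_nonneg fun i _ => zeta_nonneg _
    obtain ⟨τ, hτ⟩ := hS
    set S := permsWithin A with hSdef
    have hp : (0 : ℝ) < #S := by exact_mod_cast card_pos.2 ⟨τ, hτ⟩
    have hA : ∀ i, 0 < #(A i) := fun i => card_pos.2 ⟨_, mem_permsWithin.1 hτ i⟩
    -- Expansion along row `i`: the log-sum inequality is applied to the counts of `σ` with `σ i =
    -- k`, and the induction hypothesis bounds each count. Regrouping by `σ` allows a later
    -- summation over all `i`.
    have step : ∀ i ∈ I, (#S : ℝ) * Real.log #S ≤ ∑ σ ∈ S, (Real.log #(A i) +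
        ∑ j ∈ I.erase i, Real.log (zeta #((A j).erase (σ i)))) := by
      intro i hi
      have hmaps : ∀ σ ∈ S, σ i ∈ A i := fun σ hσ => mem_permsWithin.1 hσ i
      have hsum : (#S : ℝ) = ∑ k ∈ A i, (#(S.filter fun σ => σ i = k) : ℝ) := by
        rw [card_eq_sum_card_fiberwise hmaps]; push_cast; rfl
      have hlog := sum_mul_log_sum_le (A i) (fun k => (#(S.filter fun σ => σ i = k) : ℝ))
        (fun k _ => by positivity)
      rw [← hsum] at hlog
      refine hlog.trans ?_
      rw [sum_add_distrib, sum_const, nsmul_eq_mul]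
      gcongr
      rw [← sum_fiberwise_of_maps_to hmaps]
      refine sum_le_sum fun k hk => ?_
      have hinner : ∀ σ ∈ S.filter (fun σ => σ i = k),
          ∑ j ∈ I.erase i, Real.log (zeta #((A j).erase (σ i))) =
            ∑ j ∈ I.erase i, Real.log (zeta #((A j).erase k)) := by
        intro σ hσ
        rw [(mem_filter.1 hσ).2]
      rw [sum_congr rfl hinner, sum_const, nsmul_eq_mul]
      rcases (S.filter fun σ => σ i = k).eq_empty_or_nonempty with he | hne
      · rw [he]; simp
      gcongr
      have hpos : (0 : ℝ) < #(S.filter fun σ => σ i = k) := by exact_mod_cast card_pos.2 hne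
      have hle := ih (h.fixRow hi hk) (by rw [card_erase_of_mem hi, hm]; simp)
      rw [permsWithin_fixRow A hk] at hle
      have hcongr : ∏ j ∈ I.erase i, zeta #(fixRow A i k j) =
          ∏ j ∈ I.erase i, zeta #((A j).erase k) :=
        prod_congr rfl fun j hj => by rw [fixRow, if_neg (ne_of_mem_erase hj)]
      rw [hcongr] at hle
      -- A nonempty fibre makes the product positive, so no factor is `zeta 0 = 0`.
      rw [← Real.log_prod]
      · exact Real.log_le_log hpos hle
      · exact prod_ne_zero_iff.1 (hpos.trans_le hle).ne'
    have htot := sum_le_sum step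
    rw [sum_comm, sum_congr rfl fun σ hσ => sum_log_zeta_erase h hσ, sum_const, sum_const,
      nsmul_eq_mul, nsmul_eq_mul, ← Real.log_prod fun j _ => (zeta_pos (hA j).ne').ne'] at htot
    have hI : (0 : ℝ) < #I := by rw [hm]; positivity
    have hlog : Real.log #S ≤ Real.log (∏ j ∈ I, zeta #(A j)) := by
      have : (#I * #S : ℝ) * Real.log #S ≤
          (#I * #S : ℝ) * Real.log (∏ j ∈ I, zeta #(A j)) := by linarith
      exact le_of_mul_le_mul_left this (by positivity)
    exact (Real.log_le_log_iff hp (prod_pos fun j _ => zeta_pos (hA j).ne')).1 hlog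

end Bregman

/-! ### Elementary symmetric sums and Maclaurin's inequality -/

section SymmetricSums

variable {ι : Type*} [DecidableEq ι]

/-- Double counting: a set with a marked element is a smaller set with a marked element outside it.
-/
theorem sum_powersetCard_succ_sum_erase {M : Type*} [AddCommMonoid M] (s : Finset ι) (k : ℕ)
    (F : Finset ι → ι → M) :
    ∑ K ∈ powersetCard (k + 1) s, ∑ i ∈ K, F (K.erase i) i =
      ∑ L ∈ powersetCard k s, ∑ i ∈ s \ L, F L i := by
  rw [sum_sigma', sum_sigma']
  refine sum_bij' (fun x _ => ⟨x.1.erase x.2, x.2⟩) (fun x _ => ⟨insert x.2 x.1, x.2⟩) ?_ ?_ ?_ ?_ ?_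
  · rintro ⟨K, i⟩ h
    simp only [mem_sigma, mem_powersetCard, mem_sdiff] at h ⊢
    refine ⟨⟨(erase_subset _ _).trans h.1.1, ?_⟩, h.1.1 h.2, notMem_erase _ _⟩
    rw [card_erase_of_mem h.2, h.1.2, Nat.add_sub_cancel]
  · rintro ⟨L, i⟩ h
    simp only [mem_sigma, mem_powersetCard, mem_sdiff] at h ⊢
    refine ⟨⟨insert_subset h.2.1 h.1.1, ?_⟩, mem_insert_self _ _⟩
    rw [card_insert_of_notMem h.2.2, h.1.2]
  · rintro ⟨K, i⟩ h
    simp only [mem_sigma] at h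
    simp [insert_erase h.2]
  · rintro ⟨L, i⟩ h
    simp only [mem_sigma, mem_sdiff] at h
    simp [erase_insert h.2.2]
  · rintro ⟨K, i⟩ _
    rfl

/-- The elementary symmetric sum of degree `k` of `x` over `s`. -/
def elemSym (s : Finset ι) (x : ι → ℝ) (k : ℕ) : ℝ :=
  ∑ L ∈ powersetCard k s, ∏ i ∈ L, x i

theorem succ_mul_elemSym_succ (s : Finset ι) (x : ι → ℝ) (k : ℕ) :
    ((k : ℝ) + 1) * elemSym s x (k + 1) =
      ∑ L ∈ powersetCard k s, (∏ i ∈ L, x i) * ∑ i ∈ s \ L, x i := by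
  simp only [mul_sum]
  rw [← sum_powersetCard_succ_sum_erase s k fun L i => (∏ j ∈ L, x j) * x i, elemSym, mul_sum]
  refine sum_congr rfl fun K hK => ?_
  rw [sum_congr rfl fun i hi => prod_erase_mul K x hi, sum_const, (mem_powersetCard.1 hK).2,
    nsmul_eq_mul]
  push_cast; rfl

/-- After both sides are regrouped by the `k`-sets `M`, the claim for each `M` is Cauchy–Schwarz on
`s \ M`: `(∑ x)² ≤ (#s - k) ∑ x²`, with `∑ x²` subtracted from both sides. -/
theorem mul_sum_sdiff_le {s : Finset ι} {x : ι → ℝ} (hx : ∀ i, 0 ≤ x i) (k : ℕ) :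
    ((k : ℝ) + 1) * (∑ L ∈ powersetCard (k + 1) s, (∏ i ∈ L, x i) * ∑ i ∈ s \ L, x i) ≤
      (#s - (k + 1)) * ∑ L ∈ powersetCard (k + 1) s, (∏ i ∈ L, x i) * ∑ i ∈ L, x i := by
  have hA : ((k : ℝ) + 1) * (∑ L ∈ powersetCard (k + 1) s, (∏ i ∈ L, x i) * ∑ i ∈ s \ L, x i) =
      ∑ M ∈ powersetCard k s, ∑ i ∈ s \ M, (∏ j ∈ M, x j) * (x i * (∑ j ∈ s \ M, x j - x i)) := by
    rw [← sum_powersetCard_succ_sum_erase s k fun M i =>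
      (∏ j ∈ M, x j) * (x i * (∑ j ∈ s \ M, x j - x i)), mul_sum]
    refine sum_congr rfl fun K hK => ?_
    rw [mem_powersetCard] at hK
    have : ∀ i ∈ K, (∏ j ∈ K.erase i, x j) * (x i * (∑ j ∈ s \ K.erase i, x j - x i)) =
        (∏ j ∈ K, x j) * ∑ j ∈ s \ K, x j := by
      intro i hi
      rw [sdiff_erase (hK.1 hi), sum_insert (by simp [hi]), ← mul_assoc, prod_erase_mul K x hi,
        add_sub_cancel_left]
    rw [sum_congr rfl this, sum_const, hK.2, nsmul_eq_mul]
    push_cast; rfl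
  have hB : ∑ L ∈ powersetCard (k + 1) s, (∏ i ∈ L, x i) * ∑ i ∈ L, x i =
      ∑ M ∈ powersetCard k s, ∑ i ∈ s \ M, (∏ j ∈ M, x j) * x i ^ 2 := by
    rw [← sum_powersetCard_succ_sum_erase s k fun M i => (∏ j ∈ M, x j) * x i ^ 2]
    refine sum_congr rfl fun K _ => ?_
    rw [mul_sum]
    refine sum_congr rfl fun i hi => ?_
    rw [← prod_erase_mul K x hi]; ring
  rw [hA, hB, mul_sum]
  refine sum_le_sum fun M hM => ?_
  rw [mem_powersetCard] at hM
  rw [← mul_sum, ← mul_sum, mul_left_comm]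
  refine mul_le_mul_of_nonneg_left ?_ (prod_nonneg fun i _ => hx i)
  have hc : (#(s \ M) : ℝ) = #s - k := by
    rw [cast_card_sdiff hM.1, hM.2]
  have hcs := sq_sum_le_card_mul_sum_sq (s := s \ M) (f := x)
  rw [hc] at hcs
  simp only [mul_sub, sum_sub_distrib, ← sum_mul, ← sq]
  linarith

/-- The ratio of consecutive symmetric means is at most the arithmetic mean. The product of `∑ x`
and a symmetric sum splits according to whether the extra index lies inside or outside `L`, and
`mul_sum_sdiff_le` compares the two parts. -/
theorem elemSym_succ_step {s : Finset ι} {x : ι → ℝ} (hx : ∀ i, 0 ≤ x i) {k : ℕ} (hk : k ≤ #s) :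
    #s * ((k : ℝ) + 1) * elemSym s x (k + 1) ≤ (#s - k) * (∑ i ∈ s, x i) * elemSym s x k := by
  cases k with
  | zero =>
    have := succ_mul_elemSym_succ s x 0
    simp only [CharP.cast_eq_zero, zero_add, one_mul, powersetCard_zero, sum_singleton, prod_empty,
      sdiff_empty] at this
    rw [zero_add, this]
    simp [elemSym]
  | succ k =>
    have h1 := mul_sum_sdiff_le (s := s) hx k
    have h2 := succ_mul_elemSym_succ s x (k + 1)
    have h3 : (∑ i ∈ s, x i) * elemSym s x (k + 1) =
        (∑ L ∈ powersetCard (k + 1) s, (∏ i ∈ L, x i) * ∑ i ∈ s \ L, x i) +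
          ∑ L ∈ powersetCard (k + 1) s, (∏ i ∈ L, x i) * ∑ i ∈ L, x i := by
      rw [← sum_add_distrib, elemSym, mul_sum]
      refine sum_congr rfl fun L hL => ?_
      rw [← mul_add, sum_sdiff (mem_powersetCard.1 hL).1, mul_comm]
    rw [mul_assoc, h2, mul_assoc, h3]
    push_cast
    linarith

/-- **Maclaurin's inequality** between the elementary symmetric mean and the arithmetic mean. -/
theorem elemSym_mul_pow_le {s : Finset ι} {x : ι → ℝ} (hx : ∀ i, 0 ≤ x i) (k : ℕ) :
    elemSym s x k * (#s : ℝ) ^ k ≤ (#s).choose k * (∑ i ∈ s, x i) ^ k := by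
  induction k with
  | zero => simp [elemSym]
  | succ k ih =>
    have hS : 0 ≤ ∑ i ∈ s, x i := sum_nonneg fun i _ => hx i
    rcases lt_or_ge (#s) (k + 1) with hlt | hge
    · rw [elemSym, powersetCard_eq_empty.2 hlt, Nat.choose_eq_zero_of_lt hlt]; simp
    have hstep := elemSym_succ_step hx (show k ≤ #s by omega)
    have hch : ((#s).choose (k + 1) : ℝ) * (k + 1) = (#s).choose k * (#s - k) := by
      rw [← Nat.cast_sub (by omega)]
      exact_mod_cast Nat.choose_succ_right_eq (#s) k
    have hnk : (0 : ℝ) ≤ #s - k := by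
      rw [← Nat.cast_sub (by omega)]; positivity
    refine le_of_mul_le_mul_left ?_ (show (0 : ℝ) < (k : ℝ) + 1 by positivity)
    calc ((k : ℝ) + 1) * (elemSym s x (k + 1) * (#s : ℝ) ^ (k + 1))
        = (#s * ((k : ℝ) + 1) * elemSym s x (k + 1)) * (#s : ℝ) ^ k := by ring
      _ ≤ ((#s - k) * (∑ i ∈ s, x i) * elemSym s x k) * (#s : ℝ) ^ k := by gcongr
      _ = (#s - k) * (∑ i ∈ s, x i) * (elemSym s x k * (#s : ℝ) ^ k) := by ring
      _ ≤ (#s - k) * (∑ i ∈ s, x i) * ((#s).choose k * (∑ i ∈ s, x i) ^ k) := by gcongr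
      _ = ((k : ℝ) + 1) * ((#s).choose (k + 1) * (∑ i ∈ s, x i) ^ (k + 1)) := by
        rw [pow_succ]; linear_combination (-(∑ i ∈ s, x i) ^ k * (∑ i ∈ s, x i)) * hch

theorem elemSym_le_of_sum_le {s : Finset ι} {x : ι → ℝ} (hx : ∀ i, 0 ≤ x i) {m : ℝ}
    (hm : ∑ i ∈ s, x i ≤ #s * m) (k : ℕ) : elemSym s x k ≤ (#s).choose k * m ^ k := by
  rcases Nat.eq_zero_or_pos (#s) with h0 | hpos
  · rw [card_eq_zero.1 h0]
    cases k with
    | zero => simp [elemSym]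
    | succ k => rw [elemSym, powersetCard_eq_empty.2 (by simp)]; simp
  · have hc : (0 : ℝ) < #s := by exact_mod_cast hpos
    refine le_of_mul_le_mul_right ?_ (pow_pos hc k)
    calc elemSym s x k * (#s : ℝ) ^ k ≤ (#s).choose k * (∑ i ∈ s, x i) ^ k :=
          elemSym_mul_pow_le hx k
      _ ≤ (#s).choose k * (#s * m) ^ k := by
          gcongr
          exact sum_nonneg fun i _ => hx i
      _ = (#s).choose k * m ^ k * (#s : ℝ) ^ k := by rw [mul_pow]; ring

theorem sum_powersetCard_univ_prod_compl [Fintype ι] (x : ι → ℝ) {k : ℕ}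
    (hk : k ≤ Fintype.card ι) :
    ∑ K ∈ powersetCard k univ, ∏ i ∈ Kᶜ, x i = elemSym univ x (Fintype.card ι - k) := by
  refine sum_nbij' compl compl ?_ ?_ (fun _ _ => compl_compl _) (fun _ _ => compl_compl _)
    (fun _ _ => rfl)
  · intro K hK
    rw [mem_powersetCard] at hK ⊢
    exact ⟨subset_univ _, by rw [card_compl, hK.2]⟩
  · intro K hK
    rw [mem_powersetCard] at hK ⊢
    exact ⟨subset_univ _, by rw [card_compl, hK.2]; omega⟩

theorem sum_powersetCard_filter_prod_sdiff_pair [Fintype ι] (x : ι → ℝ) {r s : ι} (hrs : r ≠ s)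
    (k : ℕ) :
    ∑ K ∈ (powersetCard (k + 2) univ).filter (fun K => r ∈ K ∧ s ∈ K), ∏ i ∈ K \ {r, s}, x i =
      elemSym (univ \ {r, s}) x k := by
  have hc : #({r, s} : Finset ι) = 2 := card_pair hrs
  refine sum_nbij' (· \ {r, s}) (· ∪ {r, s}) ?_ ?_ ?_ ?_ (fun _ _ => rfl)
  · intro K hK
    simp only [mem_filter, mem_powersetCard] at hK ⊢
    refine ⟨sdiff_subset_sdiff (subset_univ _) subset_rfl, ?_⟩
    rw [card_sdiff_of_subset (by simp [insert_subset_iff, hK.2]), hc, hK.1.2, Nat.add_sub_cancel]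
  · intro L hL
    simp only [mem_filter, mem_powersetCard] at hL ⊢
    refine ⟨⟨subset_univ _, ?_⟩, by simp, by simp⟩
    rw [card_union_of_disjoint ((subset_sdiff.1 hL.1).2), hL.2, hc]
  · intro K hK
    simp only [mem_filter, mem_powersetCard] at hK
    exact sdiff_union_of_subset (by simp [insert_subset_iff, hK.2])
  · intro L hL
    rw [mem_powersetCard] at hL
    exact union_sdiff_cancel_right ((subset_sdiff.1 hL.1).2)

end SymmetricSums

/-! ### Telescoping over column sets and the Cauchy–Schwarz bounds -/

section Telescoping

variable {n : ℕ}

/-- The mean over all `k`-element sets `K` of columns of `P K` times the product of `z` over the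
remaining columns. -/
noncomputable def levelMean (P : Finset (Fin n) → ℝ) (z : Fin n → ℝ) (k : ℕ) : ℝ :=
  (∑ K ∈ powersetCard k univ, P K * ∏ i ∈ Kᶜ, z i) / n.choose k

theorem levelMean_zero (P : Finset (Fin n) → ℝ) (z : Fin n → ℝ) :
    levelMean P z 0 = P ∅ * ∏ i, z i := by
  simp [levelMean]

theorem levelMean_top (P : Finset (Fin n) → ℝ) (z : Fin n → ℝ) :
    levelMean P z n = P univ := by
  have h := powersetCard_self (univ : Finset (Fin n))
  rw [card_univ, Fintype.card_fin] at h
  simp [levelMean, h]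

/-- Both levels become sums over pairs `s ∈ K` with `#K = k + 1`; the normalisations agree because
`C(n, k+1) (k+1) = C(n, k) (n - k)`. -/
theorem levelMean_succ_sub (P : Finset (Fin n) → ℝ) (z : Fin n → ℝ) {k : ℕ} (hk : k < n) :
    levelMean P z (k + 1) - levelMean P z k =
      (∑ K ∈ powersetCard (k + 1) univ, ∑ s ∈ K,
        (P K - z s * P (K.erase s)) * ∏ i ∈ Kᶜ, z i) / (n.choose (k + 1) * (k + 1)) := by
  have hc1 : (0 : ℝ) < n.choose (k + 1) := by exact_mod_cast Nat.choose_pos hk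
  have hc0 : (0 : ℝ) < n.choose k := by exact_mod_cast Nat.choose_pos hk.le
  have hch : (n.choose (k + 1) : ℝ) * (k + 1) = n.choose k * (n - k) := by
    rw [← Nat.cast_sub hk.le]
    exact_mod_cast Nat.choose_succ_right_eq n k
  have hnk : (0 : ℝ) < n - k := by rw [← Nat.cast_sub hk.le]; exact_mod_cast Nat.sub_pos_of_lt hk
  have h1 : ∑ K ∈ powersetCard (k + 1) (univ : Finset (Fin n)), ∑ s ∈ K, P K * ∏ i ∈ Kᶜ, z i =
      (k + 1) * ∑ K ∈ powersetCard (k + 1) univ, P K * ∏ i ∈ Kᶜ, z i := by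
    rw [mul_sum]
    refine sum_congr rfl fun K hK => ?_
    rw [sum_const, (mem_powersetCard.1 hK).2, nsmul_eq_mul]; push_cast; rfl
  have h2 : ∑ K ∈ powersetCard (k + 1) (univ : Finset (Fin n)), ∑ s ∈ K,
      z s * P (K.erase s) * ∏ i ∈ Kᶜ, z i =
      (n - k) * ∑ K ∈ powersetCard k univ, P K * ∏ i ∈ Kᶜ, z i := by
    rw [mul_sum]
    have e1 : ∀ K ∈ powersetCard (k + 1) (univ : Finset (Fin n)),
        ∑ s ∈ K, z s * P (K.erase s) * ∏ i ∈ Kᶜ, z i =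
          ∑ s ∈ K, P (K.erase s) * ∏ i ∈ (K.erase s)ᶜ, z i := by
      intro K _
      refine sum_congr rfl fun s hs => ?_
      rw [compl_erase, prod_insert (by simpa using hs)]; ring
    rw [sum_congr rfl e1, sum_powersetCard_succ_sum_erase univ k
      fun L _ => P L * ∏ i ∈ Lᶜ, z i]
    refine sum_congr rfl fun L hL => ?_
    rw [sum_const, nsmul_eq_mul, cast_card_sdiff (subset_univ _), (mem_powersetCard.1 hL).2,
      card_univ, Fintype.card_fin]
  simp only [sub_mul, sum_sub_distrib]
  rw [h1, h2, levelMean, levelMean, sub_div]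
  congr 1
  · field_simp
  · rw [hch]; field_simp

theorem sum_sum_erase_eq_sum_offDiag {M : Type*} [AddCommMonoid M] (k : ℕ)
    (F : Finset (Fin n) → Fin n → Fin n → M) :
    ∑ K ∈ powersetCard k univ, ∑ s ∈ K, ∑ r ∈ K.erase s, F K r s =
      ∑ c ∈ (univ : Finset (Fin n)).offDiag,
        ∑ K ∈ (powersetCard k univ).filter (fun K => c.1 ∈ K ∧ c.2 ∈ K), F K c.1 c.2 := by
  have h : ∀ K : Finset (Fin n),
      ∑ s ∈ K, ∑ r ∈ K.erase s, F K r s = ∑ c ∈ K.offDiag, F K c.1 c.2 := by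
    intro K
    rw [sum_sigma']
    refine sum_nbij' (fun x => (x.2, x.1)) (fun c => ⟨c.2, c.1⟩) ?_ ?_ (fun _ _ => rfl)
      (fun _ _ => rfl) (fun _ _ => rfl)
    · rintro ⟨s, r⟩ h
      simp only [mem_sigma, mem_erase, mem_offDiag] at h ⊢
      exact ⟨h.2.2, h.1, h.2.1⟩
    · rintro ⟨r, s⟩ h
      simp only [mem_sigma, mem_erase, mem_offDiag] at h ⊢
      exact ⟨h.2.1, h.2.2, h.1⟩
  rw [sum_congr rfl fun K _ => h K]
  refine sum_comm' fun K c => ?_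
  simp only [mem_filter, mem_offDiag, mem_univ, true_and]
  tauto

variable {π : Type*} {Q : Finset π} {z : Fin n → ℝ} {a : π → Fin n → Fin n → ℝ}
  {w : π → Fin n → ℝ} {κ β : ℝ}

/-- Cauchy–Schwarz over `K`; Maclaurin on the `n - 2` columns other than `r`, `s` bounds the first
factor. -/
theorem sum_prod_mul_prod_le {w : Fin n → ℝ} {r s : Fin n}
    (hrs : r ≠ s) (hκ : ∑ l ∈ univ \ {r, s}, w l ^ 2 ≤ ((n : ℝ) - 2) * κ) (k : ℕ) :
    ∑ K ∈ (powersetCard (k + 2) univ).filter (fun K => r ∈ K ∧ s ∈ K),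
        (∏ i ∈ K \ {r, s}, w i) * ∏ i ∈ Kᶜ, z i ≤
      √((n - 2).choose k * κ ^ k) *
        √(∑ K ∈ (powersetCard (k + 2) univ).filter (fun K => r ∈ K ∧ s ∈ K),
          ∏ i ∈ Kᶜ, z i ^ 2) := by
  refine (Real.sum_mul_le_sqrt_mul_sqrt _ _ _).trans ?_
  simp only [← prod_pow]
  rw [sum_powersetCard_filter_prod_sdiff_pair (fun i => w i ^ 2) hrs]
  have hc : #((univ : Finset (Fin n)) \ {r, s}) = n - 2 := by
    rw [card_sdiff_of_subset (subset_univ _), card_pair hrs, card_univ, Fintype.card_fin]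
  have hn : 2 ≤ n := by
    have := card_le_card (subset_univ ({r, s} : Finset (Fin n)))
    rwa [card_pair hrs, card_univ, Fintype.card_fin] at this
  gcongr
  rw [← hc]
  refine elemSym_le_of_sum_le (fun i => by positivity) ?_ k
  rw [hc, Nat.cast_sub hn]
  exact_mod_cast hκ

/-- Each `K` contains `(k + 2)(k + 1)` ordered pairs, and Maclaurin applies to the complements. -/
theorem sum_offDiag_sum_prod_compl_le (hβ : ∑ i, z i ^ 2 ≤ n * β) {k : ℕ} (hk : k + 2 ≤ n) :
    ∑ c ∈ (univ : Finset (Fin n)).offDiag,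
      ∑ K ∈ (powersetCard (k + 2) univ).filter (fun K => c.1 ∈ K ∧ c.2 ∈ K),
        ∏ i ∈ Kᶜ, z i ^ 2 ≤
      ((k : ℝ) + 2) * (k + 1) * (n.choose (k + 2) * β ^ (n - (k + 2))) := by
  rw [← sum_sum_erase_eq_sum_offDiag (k + 2) fun K _ _ => ∏ i ∈ Kᶜ, z i ^ 2]
  have h : ∀ K ∈ powersetCard (k + 2) (univ : Finset (Fin n)),
      ∑ s ∈ K, ∑ r ∈ K.erase s, ∏ i ∈ Kᶜ, z i ^ 2 =
        ((k : ℝ) + 2) * (k + 1) * ∏ i ∈ Kᶜ, z i ^ 2 := by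
    intro K hK
    have hc := (mem_powersetCard.1 hK).2
    have : ∀ s ∈ K, ∑ r ∈ K.erase s, ∏ i ∈ Kᶜ, z i ^ 2 = ((k : ℝ) + 1) * ∏ i ∈ Kᶜ, z i ^ 2 := by
      intro s hs
      rw [sum_const, card_erase_of_mem hs, hc, nsmul_eq_mul]; push_cast; rfl
    rw [sum_congr rfl this, sum_const, hc, nsmul_eq_mul]; push_cast; ring
  rw [sum_congr rfl h, ← mul_sum,
    sum_powersetCard_univ_prod_compl (fun i => z i ^ 2) (by simpa using hk), Fintype.card_fin]
  gcongr
  have h2 := elemSym_le_of_sum_le (s := (univ : Finset (Fin n))) (x := fun i => z i ^ 2) (m := β)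
    (fun i => by positivity) (by simpa using hβ) (n - (k + 2))
  rwa [card_univ, Fintype.card_fin, Nat.choose_symm hk] at h2

theorem choose_mul_succ_mul_eq {n k : ℕ} (hk : k + 2 ≤ n) :
    ((n - 2).choose k : ℝ) * (n * (n - 1)) = n.choose (k + 2) * ((k + 2) * (k + 1)) := by
  obtain ⟨m, rfl⟩ : ∃ m, n = m + 2 := ⟨n - 2, by omega⟩
  have h1 := Nat.add_one_mul_choose_eq m k
  have h2 := Nat.add_one_mul_choose_eq (m + 1) (k + 1)
  have h1' : ((m : ℝ) + 1) * m.choose k = (m + 1).choose (k + 1) * (k + 1) := by exact_mod_cast h1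
  have h2' : ((m : ℝ) + 1 + 1) * (m + 1).choose (k + 1) = (m + 2).choose (k + 2) * (k + 1 + 1) := by
    exact_mod_cast h2
  rw [Nat.add_sub_cancel]
  push_cast
  linear_combination (m + 2 : ℝ) * h1' + (k + 1 : ℝ) * h2'

/-- The bound of `sum_prod_mul_prod_le` is independent of `p`, so the sum over `p` factors out and a
second Cauchy–Schwarz runs over the pairs of columns. `choose_mul_succ_mul_eq` merges the two
binomial coefficients under the roots into one, at the cost of `√(n (n - 1))`. -/
theorem sum_level_le (ha : ∀ p r s, 0 ≤ a p r s)
    (hκ0 : 0 ≤ κ) (hβ0 : 0 ≤ β) (hβ : ∑ i, z i ^ 2 ≤ n * β)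
    (hκ : ∀ p ∈ Q, ∀ r s : Fin n, r ≠ s → ∑ l ∈ univ \ {r, s}, w p l ^ 2 ≤ ((n : ℝ) - 2) * κ)
    {k : ℕ} (hk : k + 2 ≤ n) :
    ∑ K ∈ powersetCard (k + 2) univ, ∑ s ∈ K,
        (∑ r ∈ K.erase s, ∑ p ∈ Q, a p r s * ∏ q ∈ K \ {r, s}, w p q) * ∏ i ∈ Kᶜ, z i ≤
      √(∑ c ∈ (univ : Finset (Fin n)).offDiag, (∑ p ∈ Q, a p c.1 c.2) ^ 2) *
        (n.choose (k + 2) * ((k + 2) * (k + 1)) / √((n : ℝ) * (n - 1)) *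
          (√β ^ (n - (k + 2)) * √κ ^ k)) := by
  set E : Fin n × Fin n → ℝ := fun c =>
    ∑ K ∈ (powersetCard (k + 2) univ).filter (fun K => c.1 ∈ K ∧ c.2 ∈ K), ∏ i ∈ Kᶜ, z i ^ 2
    with hE
  have hE0 : ∀ c, 0 ≤ E c := fun c => sum_nonneg fun K _ => prod_nonneg fun i _ => sq_nonneg _
  have hn : (0 : ℝ) < (n : ℝ) * (n - 1) := by
    have : (2 : ℝ) ≤ n := by exact_mod_cast (show 2 ≤ n by omega)
    nlinarith
  have hch := choose_mul_succ_mul_eq hk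
  calc _ = ∑ c ∈ (univ : Finset (Fin n)).offDiag, ∑ p ∈ Q, a p c.1 c.2 *
        ∑ K ∈ (powersetCard (k + 2) univ).filter (fun K => c.1 ∈ K ∧ c.2 ∈ K),
          (∏ i ∈ K \ {c.1, c.2}, w p i) * ∏ i ∈ Kᶜ, z i := by
        simp only [sum_mul]
        rw [sum_sum_erase_eq_sum_offDiag (k + 2) fun K r s =>
          ∑ p ∈ Q, a p r s * (∏ q ∈ K \ {r, s}, w p q) * ∏ i ∈ Kᶜ, z i]
        refine sum_congr rfl fun c _ => ?_
        rw [sum_comm]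
        simp only [mul_sum, mul_assoc]
    _ ≤ ∑ c ∈ (univ : Finset (Fin n)).offDiag, ∑ p ∈ Q, a p c.1 c.2 *
        (√((n - 2).choose k * κ ^ k) * √(E c)) := by
        refine sum_le_sum fun c hc => sum_le_sum fun p hp => ?_
        refine mul_le_mul_of_nonneg_left ?_ (ha _ _ _)
        have hne := (mem_offDiag.1 hc).2.2
        exact sum_prod_mul_prod_le hne (hκ p hp _ _ hne) k
    _ = √((n - 2).choose k * κ ^ k) *
        ∑ c ∈ (univ : Finset (Fin n)).offDiag, (∑ p ∈ Q, a p c.1 c.2) * √(E c) := by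
        simp only [← sum_mul, mul_sum]
        refine sum_congr rfl fun c _ => by ring
    _ ≤ √((n - 2).choose k * κ ^ k) *
        (√(∑ c ∈ (univ : Finset (Fin n)).offDiag, (∑ p ∈ Q, a p c.1 c.2) ^ 2) *
          √(((k : ℝ) + 2) * (k + 1) * (n.choose (k + 2) * β ^ (n - (k + 2))))) := by
        gcongr
        refine (Real.sum_mul_le_sqrt_mul_sqrt _ _ _).trans ?_
        gcongr
        simp only [Real.sq_sqrt (hE0 _)]
        exact sum_offDiag_sum_prod_compl_le hβ hk
    _ = _ := by
        have e1 : √((n - 2).choose k * κ ^ k) *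
            √(((k : ℝ) + 2) * (k + 1) * (n.choose (k + 2) * β ^ (n - (k + 2)))) =
            n.choose (k + 2) * ((k + 2) * (k + 1)) / √((n : ℝ) * (n - 1)) *
              (√β ^ (n - (k + 2)) * √κ ^ k) := by
          rw [← Real.sqrt_mul (by positivity)]
          refine (Real.sqrt_eq_iff_mul_self_eq (by positivity) (by positivity)).2 ?_
          have hb : √β ^ (n - (k + 2)) * √β ^ (n - (k + 2)) = β ^ (n - (k + 2)) := by
            rw [← mul_pow, Real.mul_self_sqrt hβ0]
          have hkk : √κ ^ k * √κ ^ k = κ ^ k := by rw [← mul_pow, Real.mul_self_sqrt hκ0]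
          have hd : √((n : ℝ) * (n - 1)) * √((n : ℝ) * (n - 1)) = n * (n - 1) :=
            Real.mul_self_sqrt hn.le
          set d := √((n : ℝ) * (n - 1))
          have hC : ((n - 2).choose k : ℝ) =
              n.choose (k + 2) * ((k + 2) * (k + 1)) / (n * (n - 1)) := by
            rw [← hch, mul_div_cancel_right₀ _ hn.ne']
          rw [hC, ← hb, ← hkk, ← hd]
          ring
        rw [← e1]; ring

theorem abs_sub_prod_le {P : Finset (Fin n) → ℝ} {D : ℝ} (hn : 2 ≤ n) (hD : 0 ≤ D)
    (hP0 : P ∅ = 1) (hz : ∀ i, 0 ≤ z i)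
    (ha : ∀ p r s, 0 ≤ a p r s) (hκ0 : 0 ≤ κ) (hβ0 : 0 ≤ β)
    (hβ : ∑ i, z i ^ 2 ≤ n * β)
    (hκ : ∀ p ∈ Q, ∀ r s : Fin n, r ≠ s → ∑ l ∈ univ \ {r, s}, w p l ^ 2 ≤ ((n : ℝ) - 2) * κ)
    (hP : ∀ K : Finset (Fin n), ∀ s ∈ K, |P K - z s * P (K.erase s)| ≤
      D * ∑ r ∈ K.erase s, ∑ p ∈ Q, a p r s * ∏ q ∈ K \ {r, s}, w p q) :
    |P univ - ∏ i, z i| ≤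
      D * (√(∑ c ∈ (univ : Finset (Fin n)).offDiag, (∑ p ∈ Q, a p c.1 c.2) ^ 2) /
        √((n : ℝ) * (n - 1)) * fPoly n √β √κ) := by
  have hstep : ∀ k < n, |levelMean P z (k + 1) - levelMean P z k| ≤
      D / (n.choose (k + 1) * (k + 1)) * ∑ K ∈ powersetCard (k + 1) univ, ∑ s ∈ K,
        (∑ r ∈ K.erase s, ∑ p ∈ Q, a p r s * ∏ q ∈ K \ {r, s}, w p q) * ∏ i ∈ Kᶜ, z i := by
    intro k hk
    rw [levelMean_succ_sub P z hk, abs_div, abs_of_nonneg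
      (show (0 : ℝ) ≤ n.choose (k + 1) * (k + 1) by positivity), div_mul_eq_mul_div]
    gcongr
    rw [mul_sum]
    refine (abs_sum_le_sum_abs _ _).trans (sum_le_sum fun K _ => ?_)
    rw [mul_sum]
    refine (abs_sum_le_sum_abs _ _).trans (sum_le_sum fun s hs => ?_)
    have hz' : 0 ≤ ∏ i ∈ Kᶜ, z i := prod_nonneg fun i _ => hz i
    rw [abs_mul, abs_of_nonneg hz', ← mul_assoc]
    exact mul_le_mul_of_nonneg_right (hP K s hs) hz'
  -- For a singleton `K` the bound in `hP` is an empty sum, so the first increment vanishes; this is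
  -- why `fPoly` starts at `k = 2`.
  have h01 : levelMean P z 1 = ∏ i, z i := by
    have h := hstep 0 (by omega)
    have h0 : ∑ K ∈ powersetCard (0 + 1) (univ : Finset (Fin n)), ∑ s ∈ K,
        (∑ r ∈ K.erase s, ∑ p ∈ Q, a p r s * ∏ q ∈ K \ {r, s}, w p q) * ∏ i ∈ Kᶜ, z i = 0 := by
      refine sum_eq_zero fun K hK => sum_eq_zero fun s hs => ?_
      have : K.erase s = ∅ := by
        rw [← card_eq_zero, card_erase_of_mem hs, (mem_powersetCard.1 hK).2]
      rw [this, sum_empty, zero_mul]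
    rw [h0, mul_zero] at h
    have h' := abs_nonpos_iff.1 h
    rw [levelMean_zero, hP0] at h'
    linarith
  obtain ⟨m, rfl⟩ : ∃ m, n = m + 2 := ⟨n - 2, by omega⟩
  have htel : P univ - ∏ i, z i =
      ∑ k ∈ range (m + 1), (levelMean P z (k + 2) - levelMean P z (k + 1)) := by
    rw [sum_range_sub (fun k => levelMean P z (k + 1)), h01, levelMean_top]
  have hf : fPoly (m + 2) √β √κ =
      ∑ k ∈ range (m + 1), ((k : ℝ) + 1) * √β ^ (m + 2 - (k + 2)) * √κ ^ k := by
    rw [fPoly, ← Finset.Ico_add_one_right_eq_Icc, sum_Ico_eq_sum_range]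
    refine sum_congr (by congr 1) fun k _ => ?_
    rw [add_comm 2 k, Nat.add_sub_cancel]
    push_cast; ring
  rw [htel, hf, mul_sum, mul_sum]
  refine (abs_sum_le_sum_abs _ _).trans (sum_le_sum fun k hk => ?_)
  have hk2 : k + 2 ≤ m + 2 := by rw [mem_range] at hk; omega
  have hc : (0 : ℝ) < (m + 2).choose (k + 2) := by exact_mod_cast Nat.choose_pos hk2
  -- Dividing by `C(n, k+2) (k+2)` leaves the factor `k + 1`, the coefficient in `fPoly`.
  refine (hstep (k + 1) (by omega)).trans ?_
  refine (mul_le_mul_of_nonneg_left (sum_level_le ha hκ0 hβ0 hβ hκ hk2)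
    (by positivity)).trans_eq ?_
  push_cast
  field_simp
  ring

end Telescoping

/-! ### Random permutations, exchange of positions, and Bregman's bound -/

section Permutations

variable {N n : ℕ}

/-- Left multiplication by a permutation carrying one embedding to another shows that all fibres
have equal size; counting all permutations then gives that size. -/
theorem card_perm_restrict_eq (c e : Fin n ↪ Fin N) :
    #(univ.filter fun σ : Perm (Fin N) => c.trans σ.toEmbedding = e) = (N - n).factorial := by
  have hn : n ≤ N := by simpa using Fintype.card_le_of_embedding c
  have hconst : ∀ e' : Fin n ↪ Fin N,
      #(univ.filter fun σ : Perm (Fin N) => c.trans σ.toEmbedding = e') =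
        #(univ.filter fun σ : Perm (Fin N) => c.trans σ.toEmbedding = e) := by
    intro e'
    obtain ⟨τ, hτ'⟩ := Perm.exists_extending_pair e' e e'.injective e.injective
    refine card_bij' (fun σ _ => τ * σ) (fun σ _ => τ⁻¹ * σ) ?_ ?_ ?_ ?_
    · intro σ hσ
      simp only [mem_filter, mem_univ, true_and] at hσ ⊢
      ext r
      have := DFunLike.congr_fun hσ r
      simp only [Function.Embedding.trans_apply, coe_toEmbedding] at this
      simp [this, hτ']
    · intro σ hσ
      simp only [mem_filter, mem_univ, true_and] at hσ ⊢
      ext r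
      have := DFunLike.congr_fun hσ r
      simp only [Function.Embedding.trans_apply, coe_toEmbedding] at this
      simp [this, ← hτ']
    · intro σ _; simp
    · intro σ _; simp
  have h1 : #(univ : Finset (Perm (Fin N))) = ∑ e' : Fin n ↪ Fin N,
      #(univ.filter fun σ : Perm (Fin N) => c.trans σ.toEmbedding = e') :=
    card_eq_sum_card_fiberwise fun σ _ => mem_coe.2 (mem_univ _)
  rw [sum_congr rfl fun e' _ => hconst e', sum_const, card_univ, card_univ,
    Fintype.card_perm, Fintype.card_embedding_eq, Fintype.card_fin, Fintype.card_fin,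
    ← Nat.factorial_mul_descFactorial hn, smul_eq_mul, mul_comm] at h1
  exact (Nat.eq_of_mul_eq_mul_left (Nat.descFactorial_pos.2 hn) h1).symm

theorem sum_perm_restrict (c : Fin n ↪ Fin N) (F : (Fin n ↪ Fin N) → ℝ) :
    ∑ σ : Perm (Fin N), F (c.trans σ.toEmbedding) = (N - n).factorial * ∑ e, F e := by
  rw [← sum_fiberwise (s := univ) (g := fun σ : Perm (Fin N) => c.trans σ.toEmbedding), mul_sum]
  refine sum_congr rfl fun e _ => ?_
  rw [sum_congr rfl fun σ hσ => by rw [(mem_filter.1 hσ).2], sum_const, card_perm_restrict_eq,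
    nsmul_eq_mul]

/-- The unnormalised permanent of the columns in `K`, as a sum over all permutations. -/
def permSum (y : Fin N → Fin n → ℝ) (c : Fin n ↪ Fin N) (K : Finset (Fin n)) : ℝ :=
  ∑ σ : Perm (Fin N), ∏ r ∈ K, y (σ (c r)) r

theorem sum_perm_swap_eq (F : Perm (Fin N) → ℝ) (t t' : Fin N) :
    ∑ σ, F σ = ∑ σ : Perm (Fin N), F (σ * swap t t') :=
  (Equiv.sum_comp (Equiv.mulRight (swap t t')) F).symm

/-- The column sum is `∑ t, y (σ t) s` for every `σ`. A position `t` not used by `K.erase s` can be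
exchanged with `c s` without altering the product, so only the positions `c r` with `r ∈ K.erase s`
survive. -/
theorem permSum_sub_eq (y : Fin N → Fin n → ℝ) (c : Fin n ↪ Fin N) {K : Finset (Fin n)} {s : Fin n}
    (hs : s ∈ K) :
    N * permSum y c K - (∑ j, y j s) * permSum y c (K.erase s) =
      ∑ r ∈ K.erase s, ∑ σ : Perm (Fin N),
        (∏ q ∈ K.erase s, y (σ (c q)) q) * (y (σ (c s)) s - y (σ (c r)) s) := by
  have h1 : N * permSum y c K - (∑ j, y j s) * permSum y c (K.erase s) =
      ∑ t : Fin N, ∑ σ : Perm (Fin N),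
        (∏ q ∈ K.erase s, y (σ (c q)) q) * (y (σ (c s)) s - y (σ t) s) := by
    simp only [mul_sub, sum_sub_distrib]
    congr 1
    · rw [sum_const, card_univ, Fintype.card_fin, nsmul_eq_mul, permSum]
      congr 1
      exact sum_congr rfl fun σ _ => (prod_erase_mul K (fun r => y (σ (c r)) r) hs).symm
    · rw [sum_comm, permSum, mul_sum]
      refine sum_congr rfl fun σ _ => ?_
      rw [← mul_sum, Equiv.sum_comp σ fun j => y j s, mul_comm]
  rw [h1, ← sum_map (K.erase s) c fun t => ∑ σ : Perm (Fin N),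
        (∏ q ∈ K.erase s, y (σ (c q)) q) * (y (σ (c s)) s - y (σ t) s)]
  refine (sum_subset (subset_univ _) fun t _ ht => ?_).symm
  simp only [mul_sub, sum_sub_distrib]
  rw [sub_eq_zero, sum_perm_swap_eq _ t (c s)]
  refine sum_congr rfl fun σ _ => ?_
  rw [Perm.mul_apply, swap_apply_right]
  congr 1
  refine prod_congr rfl fun q hq => ?_
  rw [Perm.mul_apply, swap_apply_of_ne_of_ne]
  · exact fun h => ht (mem_map.2 ⟨q, hq, h⟩)
  · exact fun h => ne_of_mem_erase hq (c.injective h)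

theorem two_mul_sum_perm_exchange (y : Fin N → Fin n → ℝ) (c : Fin n ↪ Fin N)
    {K : Finset (Fin n)} {r s : Fin n} (hr : r ∈ K.erase s) :
    2 * ∑ σ : Perm (Fin N),
        (∏ q ∈ K.erase s, y (σ (c q)) q) * (y (σ (c s)) s - y (σ (c r)) s) =
      -∑ σ : Perm (Fin N), (y (σ (c r)) r - y (σ (c s)) r) * (y (σ (c r)) s - y (σ (c s)) s) *
        ∏ q ∈ K \ {r, s}, y (σ (c q)) q := by
  have hK : K \ {r, s} = (K.erase s).erase r := by
    ext q; simp only [mem_sdiff, mem_insert, mem_singleton, mem_erase]; tauto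
  have h1 : ∀ σ : Perm (Fin N), (∏ q ∈ K.erase s, y (σ (c q)) q) =
      y (σ (c r)) r * ∏ q ∈ K \ {r, s}, y (σ (c q)) q := fun σ => by
    rw [hK, mul_prod_erase (K.erase s) (fun q => y (σ (c q)) q) hr]
  simp only [h1]
  rw [two_mul]
  -- Symmetrisation: in one of the two copies the positions `c r` and `c s` are exchanged, and the
  -- sum factors into two differences.
  nth_rewrite 2 [sum_perm_swap_eq _ (c r) (c s)]
  rw [← sum_add_distrib, ← sum_neg_distrib]
  refine sum_congr rfl fun σ _ => ?_
  have h2 : ∏ q ∈ K \ {r, s}, y ((σ * swap (c r) (c s)) (c q)) q =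
      ∏ q ∈ K \ {r, s}, y (σ (c q)) q := by
    refine prod_congr rfl fun q hq => ?_
    simp only [mem_sdiff, mem_insert, mem_singleton, not_or] at hq
    rw [Perm.mul_apply, swap_apply_of_ne_of_ne (fun h => hq.2.1 (c.injective h))
      (fun h => hq.2.2 (c.injective h))]
  rw [h2]
  simp only [Perm.mul_apply, swap_apply_left, swap_apply_right]
  ring

theorem abs_permSum_sub_le {y : Fin N → Fin n → ℝ} (hy : ∀ j r, 0 ≤ y j r) (c : Fin n ↪ Fin N)
    {K : Finset (Fin n)} {s : Fin n} (hs : s ∈ K) :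
    2 * |N * permSum y c K - (∑ j, y j s) * permSum y c (K.erase s)| ≤
      ∑ r ∈ K.erase s, ∑ p ∈ (univ : Finset (Fin N)).offDiag,
        |(y p.1 r - y p.2 r) * (y p.1 s - y p.2 s)| *
          ∑ σ ∈ univ.filter (fun σ : Perm (Fin N) => σ (c r) = p.1 ∧ σ (c s) = p.2),
            ∏ q ∈ K \ {r, s}, y (σ (c q)) q := by
  have h2 : ∀ x : ℝ, 2 * |x| = |2 * x| := fun x => by rw [abs_mul, abs_two]
  rw [permSum_sub_eq y c hs, h2, mul_sum]
  refine (abs_sum_le_sum_abs _ _).trans (sum_le_sum fun r hr => ?_)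
  rw [two_mul_sum_perm_exchange y c hr, abs_neg]
  refine (abs_sum_le_sum_abs _ _).trans_eq ?_
  have hmaps : ∀ σ ∈ (univ : Finset (Perm (Fin N))),
      (σ (c r), σ (c s)) ∈ (univ : Finset (Fin N)).offDiag := by
    intro σ _
    simp only [mem_offDiag, mem_univ, true_and]
    exact fun h => ne_of_mem_erase hr (c.injective (σ.injective h))
  rw [← sum_fiberwise_of_maps_to hmaps]
  refine sum_congr rfl fun p _ => ?_
  rw [mul_sum]
  refine sum_congr (by ext; simp [Prod.ext_iff]) fun σ hσ => ?_
  simp only [mem_filter, mem_univ, true_and] at hσ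
  rw [abs_mul, hσ.1, hσ.2, abs_of_nonneg (prod_nonneg fun q _ => hy _ _)]

open Classical in
/-- The rows in which all columns of `L` sent to `i` by `c` have the entry `1`. -/
noncomputable def onesRows (Z : Matrix (Fin N) (Fin n) ℕ) (c : Fin n ↪ Fin N) (L : Finset (Fin n)) (i : Fin N) :
    Finset (Fin N) :=
  univ.filter fun j => ∀ q ∈ L, c q = i → Z j q = 1

theorem onesRows_of_notMem (Z : Matrix (Fin N) (Fin n) ℕ) (c : Fin n ↪ Fin N)
    {L : Finset (Fin n)} {i : Fin N} (h : i ∉ L.map c) : onesRows Z c L i = univ := by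
  ext j
  simp only [onesRows, mem_filter, mem_univ, true_and, iff_true]
  exact fun q hq e => absurd (mem_map.2 ⟨q, hq, e⟩) h

theorem card_onesRows_erase_erase {Z : Matrix (Fin N) (Fin n) ℕ} (hZ : ∀ j r, Z j r = 0 ∨ Z j r = 1)
    (c : Fin n ↪ Fin N) {L : Finset (Fin n)} {q : Fin n} (hq : q ∈ L) (u v : Fin N) :
    #(((onesRows Z c L (c q)).erase u).erase v) = eta Z u v q := by
  have h : ((onesRows Z c L (c q)).erase u).erase v =
      (univ \ {u, v}).filter fun j => Z j q = 1 := by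
    ext j
    simp only [onesRows, mem_erase, mem_filter, mem_univ, true_and, mem_sdiff, mem_insert,
      mem_singleton, not_or]
    constructor
    · rintro ⟨hv, hu, h⟩
      exact ⟨⟨hu, hv⟩, h q hq rfl⟩
    · rintro ⟨⟨hu, hv⟩, h⟩
      refine ⟨hv, hu, fun q' _ e => ?_⟩
      rw [c.injective e]; exact h
  rw [h, card_filter, eta]
  refine sum_congr rfl fun j _ => ?_
  rcases hZ j q with h0 | h0 <;> simp [h0]

theorem prod_entries_eq_ite {Z : Matrix (Fin N) (Fin n) ℕ} (hZ : ∀ j r, Z j r = 0 ∨ Z j r = 1)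
    (c : Fin n ↪ Fin N) (L : Finset (Fin n)) (σ : Perm (Fin N)) :
    ∏ q ∈ L, (Z (σ (c q)) q : ℝ) = if σ ∈ permsWithin (onesRows Z c L) then 1 else 0 := by
  have hiff : σ ∈ permsWithin (onesRows Z c L) ↔ ∀ q ∈ L, Z (σ (c q)) q = 1 := by
    simp only [mem_permsWithin, onesRows, mem_filter, mem_univ, true_and]
    refine ⟨fun h q hq => h (c q) q hq rfl, fun h i q hq e => ?_⟩
    rw [← e]; exact h q hq
  split_ifs with h
  · rw [hiff] at h
    exact prod_eq_one fun q hq => by rw [h q hq, Nat.cast_one]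
  · rw [hiff] at h
    push Not at h
    obtain ⟨q, hq, hne⟩ := h
    exact prod_eq_zero hq (by rw [(hZ _ _).resolve_right hne, Nat.cast_zero])

/-- The sum counts permutations with restricted positions, two of them fixed. Among the other `N -
2`, a position `c q` with `q ∈ L` keeps `eta Z u v q` values and the rest keep all `N - 2`; dividing
by `(N - 2)! = zeta (N - 2) ^ (N - 2)` leaves ratios over `L` only. -/
theorem sum_perm_fixed_pair_le {Z : Matrix (Fin N) (Fin n) ℕ} (hZ : ∀ j r, Z j r = 0 ∨ Z j r = 1)
    (c : Fin n ↪ Fin N) {L : Finset (Fin n)} {r s : Fin n} (hrs : r ≠ s) (hr : r ∉ L) (hs : s ∉ L)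
    {u v : Fin N} (huv : u ≠ v) :
    ∑ σ ∈ univ.filter (fun σ : Perm (Fin N) => σ (c r) = u ∧ σ (c s) = v),
        ∏ q ∈ L, (Z (σ (c q)) q : ℝ) ≤
      (N - 2).factorial * ∏ q ∈ L, (zeta (eta Z u v q) / zeta (N - 2)) := by
  set B := onesRows Z c L with hB
  set A := fixRow (fixRow B (c r) u) (c s) v with hA
  have hcrs : c s ≠ c r := fun h => hrs (c.injective h).symm
  have hmem : ∀ {t : Fin n}, t ∉ L → c t ∉ L.map c := fun ht => by simpa using ht
  have hu : u ∈ B (c r) := by rw [hB, onesRows_of_notMem Z c (hmem hr)]; exact mem_univ _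
  have hv : v ∈ fixRow B (c r) u (c s) := by
    rw [fixRow, if_neg hcrs, hB, onesRows_of_notMem Z c (hmem hs)]
    exact mem_erase.2 ⟨huv.symm, mem_univ _⟩
  have hsum : ∑ σ ∈ univ.filter (fun σ : Perm (Fin N) => σ (c r) = u ∧ σ (c s) = v),
      ∏ q ∈ L, (Z (σ (c q)) q : ℝ) = #(permsWithin A) := by
    rw [hA, permsWithin_fixRow _ hv, permsWithin_fixRow _ hu, filter_filter,
      sum_congr rfl fun σ _ => prod_entries_eq_ite hZ c L σ, ← hB, sum_boole, filter_filter]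
    congr 2
    ext σ
    simp only [mem_filter, mem_univ, true_and]
    tauto
  have hI : RowsFixedOff ((univ.erase (c r)).erase (c s)) A := by
    have h0 : RowsFixedOff univ B := fun i hi => absurd (mem_univ i) hi
    exact (h0.fixRow (mem_univ _) hu).fixRow (mem_erase.2 ⟨hcrs, mem_univ _⟩) hv
  rw [hsum]
  refine (card_permsWithin_le hI).trans_eq ?_
  have hAi : ∀ i ∈ (univ.erase (c r)).erase (c s), A i = ((B i).erase u).erase v := by
    intro i hi
    simp only [mem_erase, mem_univ, and_true] at hi
    rw [hA, fixRow, if_neg hi.1, fixRow, if_neg hi.2]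
  rw [prod_congr rfl fun i hi => by rw [hAi i hi]]
  have hsub : L.map c ⊆ (univ.erase (c r)).erase (c s) := by
    intro i hi
    obtain ⟨q, hq, rfl⟩ := mem_map.1 hi
    simp only [mem_erase, mem_univ, and_true]
    exact ⟨fun h => hs (c.injective h ▸ hq), fun h => hr (c.injective h ▸ hq)⟩
  have hcard : #((univ.erase (c r)).erase (c s)) = N - 2 := by
    rw [card_erase_of_mem (mem_erase.2 ⟨hcrs, mem_univ _⟩), card_erase_of_mem (mem_univ _),
      card_univ, Fintype.card_fin]
    omega
  have hLN : #L ≤ N - 2 := by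
    rw [← hcard, ← card_map c]; exact card_le_card hsub
  rw [← prod_sdiff hsub, prod_map,
    prod_congr (s₁ := L) rfl fun q hq => by rw [hB, card_onesRows_erase_erase hZ c hq]]
  have hrest : ∀ i ∈ (univ.erase (c r)).erase (c s) \ L.map c,
      zeta #(((B i).erase u).erase v) = zeta (N - 2) := by
    intro i hi
    rw [hB, onesRows_of_notMem Z c (mem_sdiff.1 hi).2,
      card_erase_of_mem (mem_erase.2 ⟨huv.symm, mem_univ _⟩), card_erase_of_mem (mem_univ _),
      card_univ, Fintype.card_fin]
    rfl
  rw [prod_congr rfl hrest, prod_const, card_sdiff_of_subset hsub, hcard, card_map,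
    prod_div_distrib, prod_const, ← zeta_pow_self]
  -- For `N = 2` the denominator `zeta 0` is zero, but then `L` is empty.
  rcases Nat.eq_zero_or_pos (#L) with h0 | hpos
  · rw [card_eq_zero] at h0
    subst h0; simp
  · have hz : zeta (N - 2) ≠ 0 := (zeta_pos (by omega)).ne'
    rw [pow_sub₀ _ hz hLN]
    field_simp

end Permutations

/-! ### Assembling the bound with `kappaTilde` -/

section Assembly

variable {N n : ℕ}

theorem kappaTildeEntry_eq_sq (hN : 3 ≤ N) (Z : Matrix (Fin N) (Fin n) ℕ) (u v : Fin N)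
    (l : Fin n) : kappaTildeEntry Z u v l = (zeta (eta Z u v l) / zeta (N - 2)) ^ 2 := by
  have h : zeta (N - 2) ^ 2 = ((N - 2).factorial : ℝ) ^ (2 / ((N : ℝ) - 2)) := by
    rw [zeta, if_neg (by omega), ← Real.rpow_mul_natCast (by positivity), Nat.cast_sub (by omega)]
    congr 1
    push_cast
    ring
  rw [kappaTildeEntry, div_pow, h]

theorem kappaTilde_nonneg (Z : Matrix (Fin N) (Fin n) ℕ) : 0 ≤ kappaTilde Z := by
  unfold kappaTilde
  split_ifs with h
  · have hn : (0 : ℝ) ≤ (n : ℝ) - 2 := by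
      have : (3 : ℝ) ≤ n := by exact_mod_cast h
      linarith
    refine mul_nonneg (by positivity) (Real.iSup_nonneg fun q => sum_nonneg fun l _ => ?_)
    unfold kappaTildeEntry
    positivity
  · exact zero_le_one

theorem sum_sq_le_kappaTilde (hnN : n ≤ N) (Z : Matrix (Fin N) (Fin n) ℕ) {u v : Fin N}
    (huv : u ≠ v) {r s : Fin n} (hrs : r ≠ s) :
    ∑ l ∈ univ \ {r, s}, (zeta (eta Z u v l) / zeta (N - 2)) ^ 2 ≤
      ((n : ℝ) - 2) * kappaTilde Z := by
  have hc : #((univ : Finset (Fin n)) \ {r, s}) = n - 2 := by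
    rw [card_sdiff_of_subset (subset_univ _), card_pair hrs, card_univ, Fintype.card_fin]
  have hn : 2 ≤ n := by
    have := card_le_card (subset_univ ({r, s} : Finset (Fin n)))
    rwa [card_pair hrs, card_univ, Fintype.card_fin] at this
  -- For `n = 2` both sides are zero, whatever value `kappaTilde` has there.
  rcases hn.eq_or_lt with rfl | h3
  · rw [card_eq_zero.1 hc]; simp
  have hpos : (0 : ℝ) < (n : ℝ) - 2 := by
    have : (3 : ℝ) ≤ n := by exact_mod_cast h3
    linarith
  rw [kappaTilde, if_pos (show 3 ≤ n from h3), ← mul_assoc, mul_one_div_cancel hpos.ne', one_mul]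
  simp only [← kappaTildeEntry_eq_sq (show 3 ≤ N by omega)]
  exact le_ciSup (f := fun q : {p : Fin N × Fin N // p.1 ≠ p.2} ×
      {c : Fin n × Fin n // c.1 ≠ c.2} =>
        ∑ l ∈ univ \ {q.2.1.1, q.2.1.2}, kappaTildeEntry Z q.1.1.1 q.1.1.2 l)
    (Set.finite_range _).bddAbove (⟨(u, v), huv⟩, ⟨(r, s), hrs⟩)

theorem factorial_eq_mul_factorial_sub_two (hN : 2 ≤ N) :
    (N.factorial : ℝ) = N * (N - 1) * (N - 2).factorial := by
  obtain ⟨m, rfl⟩ : ∃ m, N = m + 2 := ⟨N - 2, by omega⟩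
  rw [Nat.add_sub_cancel, Nat.factorial_succ, Nat.factorial_succ]
  push_cast; ring

/-- In the constant, `1/2` comes from the symmetrisation, `1/N` from the column mean, and `1/(N (N -
1))` is `(N - 2)! / N!`. -/
theorem abs_permSum_div_sub_mul_le (hN : 2 ≤ N) {Z : Matrix (Fin N) (Fin n) ℕ}
    (hZ : ∀ j r, Z j r = 0 ∨ Z j r = 1) (c : Fin n ↪ Fin N) {K : Finset (Fin n)} {s : Fin n}
    (hs : s ∈ K) :
    |permSum (fun j r => (Z j r : ℝ)) c K / N.factorial -
        1 / (N : ℝ) * (∑ j, (Z j s : ℝ)) *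
          (permSum (fun j r => (Z j r : ℝ)) c (K.erase s) / N.factorial)| ≤
      1 / (2 * N * (N * ((N : ℝ) - 1))) *
        ∑ r ∈ K.erase s, ∑ p ∈ (univ : Finset (Fin N)).offDiag,
          |((Z p.1 r : ℝ) - Z p.2 r) * ((Z p.1 s : ℝ) - Z p.2 s)| *
            ∏ q ∈ K \ {r, s}, (zeta (eta Z p.1 p.2 q) / zeta (N - 2)) := by
  have hN2 : (2 : ℝ) ≤ N := by exact_mod_cast hN
  have hN0 : (0 : ℝ) < N := by linarith
  have hN1 : (0 : ℝ) < (N : ℝ) - 1 := by linarith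
  have hf : (0 : ℝ) < N.factorial := by exact_mod_cast N.factorial_pos
  have hf2 : (0 : ℝ) < (N - 2).factorial := by exact_mod_cast (N - 2).factorial_pos
  have h1 := abs_permSum_sub_le (y := fun j r => (Z j r : ℝ)) (fun j r => by positivity) c hs
  have h2 : ∑ r ∈ K.erase s, ∑ p ∈ (univ : Finset (Fin N)).offDiag,
      |((Z p.1 r : ℝ) - Z p.2 r) * ((Z p.1 s : ℝ) - Z p.2 s)| *
        ∑ σ ∈ univ.filter (fun σ : Perm (Fin N) => σ (c r) = p.1 ∧ σ (c s) = p.2),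
          ∏ q ∈ K \ {r, s}, (Z (σ (c q)) q : ℝ) ≤
      (N - 2).factorial * ∑ r ∈ K.erase s, ∑ p ∈ (univ : Finset (Fin N)).offDiag,
        |((Z p.1 r : ℝ) - Z p.2 r) * ((Z p.1 s : ℝ) - Z p.2 s)| *
          ∏ q ∈ K \ {r, s}, (zeta (eta Z p.1 p.2 q) / zeta (N - 2)) := by
    rw [mul_sum]
    refine sum_le_sum fun r hr => ?_
    rw [mul_sum]
    refine sum_le_sum fun p hp => ?_
    rw [mul_left_comm]
    exact mul_le_mul_of_nonneg_left (sum_perm_fixed_pair_le hZ c (ne_of_mem_erase hr)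
      (by simp) (by simp) (mem_offDiag.1 hp).2.2) (abs_nonneg _)
  have h3 := h1.trans h2
  have h4 : permSum (fun j r => (Z j r : ℝ)) c K / N.factorial -
      1 / (N : ℝ) * (∑ j, (Z j s : ℝ)) *
        (permSum (fun j r => (Z j r : ℝ)) c (K.erase s) / N.factorial) =
      (N * permSum (fun j r => (Z j r : ℝ)) c K -
        (∑ j, (Z j s : ℝ)) * permSum (fun j r => (Z j r : ℝ)) c (K.erase s)) /
          (N * N.factorial) := by
    field_simp
  rw [h4, abs_div, abs_of_pos (by positivity : (0 : ℝ) < N * N.factorial),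
    div_le_iff₀ (by positivity), factorial_eq_mul_factorial_sub_two hN]
  refine (le_div_iff₀' two_pos).2 h3 |>.trans_eq ?_
  field_simp

/-- The approximation of the permanent of a `0`-`1` matrix over the reals. -/
theorem abs_permSum_div_sub_prod_le (hn : 2 ≤ n) (hnN : n ≤ N) {Z : Matrix (Fin N) (Fin n) ℕ}
    (hZ : ∀ j r, Z j r = 0 ∨ Z j r = 1) (c : Fin n ↪ Fin N) {β : ℝ}
    (hβ : β = (1 / (n : ℝ)) * ∑ r, (1 / (N : ℝ) * ∑ j, (Z j r : ℝ)) ^ 2) :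
    |permSum (fun j r => (Z j r : ℝ)) c univ / N.factorial -
        ∏ r, (1 / (N : ℝ) * ∑ j, (Z j r : ℝ))| ≤
      1 / (2 * N * (N * ((N : ℝ) - 1))) *
        (√(∑ d ∈ (univ : Finset (Fin n)).offDiag, (∑ p ∈ (univ : Finset (Fin N)).offDiag,
            |((Z p.1 d.1 : ℝ) - Z p.2 d.1) * ((Z p.1 d.2 : ℝ) - Z p.2 d.2)|) ^ 2) /
          √((n : ℝ) * (n - 1)) * fPoly n √β √(kappaTilde Z)) := by
  have hN2 : (2 : ℝ) ≤ N := by exact_mod_cast hn.trans hnN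
  have hN0 : (0 : ℝ) < N := by linarith
  have hN1 : (0 : ℝ) < (N : ℝ) - 1 := by linarith
  have hn0 : (0 : ℝ) < n := by exact_mod_cast (show 0 < n by omega)
  have hf : (0 : ℝ) < N.factorial := by exact_mod_cast N.factorial_pos
  have h0 : permSum (fun j r => (Z j r : ℝ)) c ∅ / N.factorial = 1 := by
    simp only [permSum, prod_empty, sum_const, card_univ, Fintype.card_perm, Fintype.card_fin,
      nsmul_eq_mul, mul_one]
    exact div_self hf.ne'
  have hβ0 : 0 ≤ β := by rw [hβ]; positivity
  have hβ' : ∑ r, (1 / (N : ℝ) * ∑ j, (Z j r : ℝ)) ^ 2 ≤ n * β := by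
    rw [hβ, ← mul_assoc, mul_one_div_cancel hn0.ne', one_mul]
  exact abs_sub_prod_le (D := 1 / (2 * N * (N * ((N : ℝ) - 1))))
    (Q := (univ : Finset (Fin N)).offDiag) (z := fun r => 1 / (N : ℝ) * ∑ j, (Z j r : ℝ))
    (P := fun K => permSum (fun j r => (Z j r : ℝ)) c K / N.factorial)
    (a := fun p r s => |((Z p.1 r : ℝ) - Z p.2 r) * ((Z p.1 s : ℝ) - Z p.2 s)|)
    (w := fun p l => zeta (eta Z p.1 p.2 l) / zeta (N - 2)) hn (by positivity) h0
    (fun r => by positivity) (fun p r s => abs_nonneg _) (kappaTilde_nonneg Z) hβ0 hβ'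
    (fun p hp r s hrs => sum_sq_le_kappaTilde hnN Z (mem_offDiag.1 hp).2.2 hrs)
    (fun K s hs => abs_permSum_div_sub_mul_le (hn.trans hnN) hZ c hs)

end Assembly

end PermanentApprox

theorem mainTheorem4 {N n : ℕ} (hn : 2 ≤ n) (hnN : n ≤ N)
    (Z : Matrix (Fin N) (Fin n) ℕ) (hZ : ∀ j r, Z j r = 0 ∨ Z j r = 1) :
    ‖((N - n).factorial : ℂ) / (N.factorial : ℂ) *
          PermanentApprox.rectPermanent (Z.map (fun m : ℕ => (m : ℂ)))
        - ∏ r : Fin n, PermanentApprox.colMean (Z.map (fun m : ℕ => (m : ℂ))) r‖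
      ≤ PermanentApprox.vartheta (Z.map (fun m : ℕ => (m : ℂ))) / (2 * (N : ℝ)) *
          PermanentApprox.fPoly n
            (Real.sqrt (PermanentApprox.beta (Z.map (fun m : ℕ => (m : ℂ)))))
            (Real.sqrt (PermanentApprox.kappaTilde Z)) := by
  have hmean : ∀ r, PermanentApprox.colMean (Z.map (fun m : ℕ => (m : ℂ))) r =
      ((1 / (N : ℝ) * ∑ j, (Z j r : ℝ) : ℝ) : ℂ) := by
    intro r
    simp [PermanentApprox.colMean]
  have hbeta : PermanentApprox.beta (Z.map (fun m : ℕ => (m : ℂ))) =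
      (1 / (n : ℝ)) * ∑ r, (1 / (N : ℝ) * ∑ j, (Z j r : ℝ)) ^ 2 := by
    simp only [PermanentApprox.beta, hmean, Complex.norm_real, Real.norm_eq_abs, sq_abs]
  have hnorm : ∀ (p : Fin N × Fin N) (d : Fin n × Fin n),
      ‖((Z.map (fun m : ℕ => (m : ℂ))) p.1 d.1 - (Z.map (fun m : ℕ => (m : ℂ))) p.2 d.1) *
        ((Z.map (fun m : ℕ => (m : ℂ))) p.1 d.2 - (Z.map (fun m : ℕ => (m : ℂ))) p.2 d.2)‖ =
        |((Z p.1 d.1 : ℝ) - Z p.2 d.1) * ((Z p.1 d.2 : ℝ) - Z p.2 d.2)| := by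
    intro p d
    rw [← Real.norm_eq_abs, ← Complex.norm_real]
    simp
  have hper : ((N - n).factorial : ℂ) / (N.factorial : ℂ) *
      PermanentApprox.rectPermanent (Z.map (fun m : ℕ => (m : ℂ))) =
      ((PermanentApprox.permSum (fun j r => (Z j r : ℝ)) (Fin.castLEEmb hnN) Finset.univ /
        N.factorial : ℝ) : ℂ) := by
    -- Each injection is the restriction of exactly `(N - n)!` permutations, which accounts for the
    -- normalisation of the permanent.
    have h := PermanentApprox.sum_perm_restrict (Fin.castLEEmb hnN)
      fun e => ∏ r, (Z (e r) r : ℝ)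
    rw [PermanentApprox.permSum]
    simp only [Function.Embedding.trans_apply, Equiv.coe_toEmbedding] at h
    rw [h]
    simp only [PermanentApprox.rectPermanent, Matrix.map_apply]
    push_cast
    ring
  have key := PermanentApprox.abs_permSum_div_sub_prod_le hn hnN hZ (Fin.castLEEmb hnN) hbeta
  rw [hper, Finset.prod_congr rfl fun r _ => hmean r, ← Complex.ofReal_prod, ← Complex.ofReal_sub,
    Complex.norm_real, Real.norm_eq_abs]
  refine key.trans_eq ?_
  simp only [PermanentApprox.vartheta, hnorm]
  rw [one_div_mul_eq_div, one_div_mul_eq_div, div_mul_eq_mul_div, div_div, div_div,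
    div_mul_eq_mul_div]
  congr 1
  ring
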